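/- Work on $\mathbb{R}^3$ with Cartesian coordinates $x^1,x^2,x^3$ and $r=|x|$, with summation over repeated indices from $1$ to $3$; for a one-form $\omega=\omega_i\,dx^i$ write $\omega_{i,j}=\partial_j\omega_i$ and $\nabla\cdot\omega=\omega_{i,i}$, and for a function $\eta$ write $\eta_i=\partial_i\eta$. A vacuum solution of the flatly foliated relativity (FFR) equations with cosmological constant $\Lambda$ is a pair $(\omega,\eta)$ of a smooth one-form and a smooth function $\eta>0$ on $\mathbb{R}^3$ (a slice of constant time) such that $$2\Lambda=\frac1{\eta^2}\Big[(\nabla\cdot\omega)^2-\tfrac14\sum_{i,j=1}^3(\omega_{i,j}+\omega_{j,i})^2\Big],$$ $$0=\frac1\eta\big(\Delta\omega_i-\partial_i(\nabla\cdot\omega)\big)+\frac2{\eta^2}(\nabla\cdot\omega)\,\eta_i-\frac1{\eta^2}(\omega_{i,j}+\omega_{j,i})\,\eta_j,\qquad i=1,2,3.$$ It is spherically symmetric at infinity if for some $r_0>0$ and some functions $w,h$ of $r$ we have $\omega=w(r)\,dr$ and $\eta=h(r)$ for all $r\ge r_0$. The arrow of time convention is that the mean curvature $K=(\nabla\cdot\omega)/\eta$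 is positive everywhere. Suppose $\Lambda>0$. Then: 1. The pair $\omega=\sqrt{\Lambda/3}\;r\,dr$, $\eta=1$ is a vacuum solution which is spherically symmetric at infinity and obeys the arrow of time convention. 2. It is the only one up to rescaling of time: if $(\omega,\eta)$ is a vacuum solution which is spherically symmetric at infinity and obeys the arrow of time convention, then there is a constant $c>0$ with $\omega=c\sqrt{\Lambda/3}\;r\,dr$ and $\eta=c$ on all of $\mathbb{R}^3$. 3. Without the arrow of time convention, uniqueness holds up to rescaling and reversal of time: if $(\omega,\eta)$ is a vacuum solution which is spherically symmetric at infinity, then there is a constant $c>0$ such that $\eta=c$ and either $\omega=c\sqrt{\Lambda/3}\;r\,dr$ or $\omega=-c\sqrt{\Lambda/3}\;r\,dr$ on all of $\mathbb{R}^3$. -/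

import Mathlib

/-- A Euclidean slice `ℝ³` with its standard flat metric. -/
abbrev Slice : Type := EuclideanSpace ℝ (Fin 3)

noncomputable section

namespace FFR

/-- The coordinate derivative `∂ᵢ u` of a real function on the slice. -/
def pd (i : Fin 3) (u : Slice → ℝ) (x : Slice) : ℝ :=
  fderiv ℝ u x (EuclideanSpace.single i 1)

/-- `ω_{i,j}`: the derivative in the direction `∂ⱼ` of the `i`-th component of the one-form
`ω = ω₁ dx¹ + ω₂ dx² + ω₃ dx³`. A one-form is given by its vector of components. -/
def dcomp (ω : Slice → Slice) (i j : Fin 3) : Slice → ℝ :=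
  pd j (fun y => ω y i)

/-- `∇ · ω = ω_{i,i}`. -/
def divergence (ω : Slice → Slice) (x : Slice) : ℝ :=
  ∑ i, dcomp ω i i x

/-- `Δ ω_i = ω_{i,jj}`. -/
def laplacianComp (ω : Slice → Slice) (i : Fin 3) (x : Slice) : ℝ :=
  ∑ j, pd j (dcomp ω i j) x

/-- First flatly foliated relativity equation (energy density):
`2Λ + 16πμ = η⁻² [ (∇·ω)² - ¼ ‖ω_{i,j} + ω_{j,i}‖² ]`. -/
def EnergyEquation (Λ : ℝ) (μ : Slice → ℝ) (ω : Slice → Slice) (η : Slice → ℝ) : Prop :=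
  ∀ x, 2 * Λ + 16 * Real.pi * μ x =
    1 / η x ^ 2 *
      (divergence ω x ^ 2 - 1 / 4 * ∑ i, ∑ j, (dcomp ω i j x + dcomp ω j i x) ^ 2)

/-- Second flatly foliated relativity equation (momentum density), for `i = 1, 2, 3`:
`16πJ_i = η⁻¹ (Δω_i - d(∇·ω)_i) + 2η⁻² (∇·ω) η_i - η⁻² (ω_{i,j} + ω_{j,i}) η_j`. -/
def MomentumEquation (J : Slice → Slice) (ω : Slice → Slice) (η : Slice → ℝ) : Prop :=
  ∀ x, ∀ i, 16 * Real.pi * J x i =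
    1 / η x * (laplacianComp ω i x - pd i (divergence ω) x)
      + 2 / η x ^ 2 * divergence ω x * pd i η x
      - 1 / η x ^ 2 * ∑ j, (dcomp ω i j x + dcomp ω j i x) * pd j η x

/-- A smooth solution `(ω, η)`, with `η > 0`, of the flatly foliated relativity equations on a
slice, with cosmological constant `Λ`, energy density `μ` and momentum density `J`. -/
structure IsSolution (Λ : ℝ) (μ : Slice → ℝ) (J : Slice → Slice)
    (ω : Slice → Slice) (η : Slice → ℝ) : Prop where
  smooth_omega : ContDiff ℝ (⊤ : ℕ∞) ω
  smooth_eta : ContDiff ℝ (⊤ : ℕ∞) η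
  eta_pos : ∀ x, 0 < η x
  energy : EnergyEquation Λ μ ω η
  momentum : MomentumEquation J ω η

/-- A vacuum solution: `μ = 0` and `J = 0`. -/
def IsVacuumSolution (Λ : ℝ) (ω : Slice → Slice) (η : Slice → ℝ) : Prop :=
  IsSolution Λ (fun _ => 0) (fun _ => 0) ω η

/-- Spherically symmetric at infinity: for some `r₀ > 0`, on the region `r ≥ r₀` one has
`ω = w(r) dr` and `η = h(r)`. The components of `dr` are those of `x / |x|`. -/
def SphericallySymmetricAtInfinity (ω : Slice → Slice) (η : Slice → ℝ) : Prop :=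
  ∃ r₀ : ℝ, 0 < r₀ ∧ ∃ w h : ℝ → ℝ, ∀ x : Slice, r₀ ≤ ‖x‖ →
    ω x = w ‖x‖ • (‖x‖⁻¹ • x) ∧ η x = h ‖x‖

/-- The arrow of time convention: the mean curvature `K = (∇·ω)/η` of the slice is positive,
so that the normal `n` points in the direction of the mean curvature vector. -/
def ArrowOfTime (ω : Slice → Slice) (η : Slice → ℝ) : Prop :=
  ∀ x, 0 < divergence ω x / η x

/-- Two pairs agree up to a rescaling of the coordinate time `t`: they differ by an overall
positive multiplicative constant. -/
def SameUpToTimeRescaling (ω₁ : Slice → Slice) (η₁ : Slice → ℝ)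
    (ω₂ : Slice → Slice) (η₂ : Slice → ℝ) : Prop :=
  ∃ c : ℝ, 0 < c ∧ ∀ x, ω₁ x = c • ω₂ x ∧ η₁ x = c * η₂ x

/-- The one-form `√(Λ/3) r dr`; recall `r dr = x dx + y dy + z dz`. -/
def omegaVac (Λ : ℝ) (x : Slice) : Slice := Real.sqrt (Λ / 3) • x

/-- The constant function `η = 1`. -/
def etaVac (_x : Slice) : ℝ := 1

end FFR

end

/-! Two flux arguments, each valid for one sign of the mass, force the mass to vanish. Outside a
ball the equations reduce to ODEs (`exists_exterior_form`): `η` is a constant `c`, `ω = W r dr`, and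
`C = r³(W² - c²Λ/3)` is constant.

Write `l = √(Λ/3)`. The momentum equation says that `T = Kδ - K_ij` is divergence free, so
contracting `T` with a vector field gives a field with computable divergence. With the position
field, `div_curvatureField` gives `2(K - 3l)`, nonnegative by the energy equation and the arrow of
time; the field points inward far out if `C ≤ 0`. With `ω`, after adding the null Lagrangian tensor
`(∇·ω)δ - ω_{i,j}`, `div_lapseField` gives `2Λ(η - c)²` plus the squared antisymmetric part of `∂ω`;
this field points inward if `C ≥ 0`.

By `div_eq_zero_of_inward` an inward field with nonnegative divergence is divergence free and is
tangential somewhere far out, so `C = 0`. Then both arguments apply: `K = 3l`, `η = c` and `ω` is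
closed. The energy equation becomes the equality case of Cauchy–Schwarz, whence `ω_{i,j} = c l
δ_ij`.

Without the arrow of time, `K² ≥ 3Λ` keeps `K` from changing sign, and `ω ↦ -ω` reduces to the
previous case. -/

namespace FFR

open MeasureTheory

/-! ### Coordinate derivatives -/

section Calculus

theorem pd_const (i : Fin 3) (a : ℝ) (x : Slice) : pd i (fun _ => a) x = 0 := by
  simp [pd]

theorem pd_coord (i j : Fin 3) (x : Slice) :
    pd i (fun y => y j) x = if i = j then 1 else 0 := by
  have h : HasFDerivAt (fun y : Slice => y j) (EuclideanSpace.proj (𝕜 := ℝ) j) x :=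
    (EuclideanSpace.proj (𝕜 := ℝ) j).hasFDerivAt
  simp [pd, h.fderiv, eq_comm]

variable {f g : Slice → ℝ} {x : Slice}

theorem pd_neg (i : Fin 3) : pd i (fun y => -f y) x = -pd i f x := by
  simp [pd, fderiv_fun_neg]

theorem pd_add (i : Fin 3) (hf : DifferentiableAt ℝ f x) (hg : DifferentiableAt ℝ g x) :
    pd i (fun y => f y + g y) x = pd i f x + pd i g x := by
  simp [pd, fderiv_fun_add hf hg]

theorem pd_sub (i : Fin 3) (hf : DifferentiableAt ℝ f x) (hg : DifferentiableAt ℝ g x) :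
    pd i (fun y => f y - g y) x = pd i f x - pd i g x := by
  simp [pd, fderiv_fun_sub hf hg]

theorem pd_mul (i : Fin 3) (hf : DifferentiableAt ℝ f x) (hg : DifferentiableAt ℝ g x) :
    pd i (fun y => f y * g y) x = pd i f x * g x + f x * pd i g x := by
  simp [pd, fderiv_fun_mul hf hg]
  ring

theorem pd_const_mul (i : Fin 3) (a : ℝ) (hf : DifferentiableAt ℝ f x) :
    pd i (fun y => a * f y) x = a * pd i f x := by
  simp [pd, fderiv_const_mul hf]

theorem pd_div (i : Fin 3) (hf : DifferentiableAt ℝ f x) (hg : DifferentiableAt ℝ g x)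
    (h0 : g x ≠ 0) :
    pd i (fun y => f y / g y) x = (pd i f x * g x - f x * pd i g x) / g x ^ 2 := by
  have hi : HasFDerivAt (fun y => (g y)⁻¹) (-(g x ^ 2)⁻¹ • fderiv ℝ g x) x :=
    (hasDerivAt_inv h0).comp_hasFDerivAt x hg.hasFDerivAt
  have h : fderiv ℝ (fun y => f y * (g y)⁻¹) x = _ := (hf.hasFDerivAt.mul hi).fderiv
  simp only [div_eq_mul_inv]
  simp only [pd, h]
  simp
  field_simp
  ring

theorem pd_sum {ι : Type*} (s : Finset ι) (i : Fin 3) {F : ι → Slice → ℝ}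
    (hF : ∀ k ∈ s, DifferentiableAt ℝ (F k) x) :
    pd i (fun y => ∑ k ∈ s, F k y) x = ∑ k ∈ s, pd i (F k) x := by
  simp [pd, fderiv_fun_sum hF]

theorem pd_congr {U : Set Slice} (hU : IsOpen U) (hx : x ∈ U) (h : ∀ y ∈ U, f y = g y)
    (i : Fin 3) : pd i f x = pd i g x := by
  have : f =ᶠ[nhds x] g := Filter.eventuallyEq_of_mem (hU.mem_nhds hx) h
  simp [pd, this.fderiv_eq]

theorem contDiff_pd (i : Fin 3) (hf : ContDiff ℝ (⊤ : ℕ∞) f) : ContDiff ℝ (⊤ : ℕ∞) (pd i f) :=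
  (hf.fderiv_right (m := (⊤ : ℕ∞)) (by simp)).clm_apply contDiff_const

theorem pd_comm (i j : Fin 3) (hf : ContDiff ℝ (⊤ : ℕ∞) f) : pd i (pd j f) x = pd j (pd i f) x := by
  have hd : DifferentiableAt ℝ (fderiv ℝ f) x :=
    (hf.fderiv_right (m := (⊤ : ℕ∞)) (by simp)).differentiable (by simp) x
  have hsymm : IsSymmSndFDerivAt ℝ f x :=
    (contDiff_infty.1 hf 2).contDiffAt.isSymmSndFDerivAt (by simp)
  have key (k l : Fin 3) : pd k (pd l f) x =
      fderiv ℝ (fderiv ℝ f) x (EuclideanSpace.single k 1) (EuclideanSpace.single l 1) := by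
    have h := hd.hasFDerivAt.clm_apply
      (hasFDerivAt_const (EuclideanSpace.single l (1 : ℝ) : Slice) x)
    have h' : fderiv ℝ (pd l f) x = _ := h.fderiv
    simp [pd, h']
  rw [key, key]
  exact hsymm _ _

theorem fderiv_eq_zero_of_pd (h : ∀ i, pd i f x = 0) : fderiv ℝ f x = 0 := by
  ext v
  have hv : v = ∑ i, v i • EuclideanSpace.single i (1 : ℝ) := by
    ext k
    simp [Pi.single_apply]
  rw [hv, map_sum]
  simp only [map_smul]
  simp only [pd] at h
  simp [h]

end Calculus

/-! ### Divergence theorem with a radial cutoff -/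

theorem integral_mul_pd {f g : Slice → ℝ} (i : Fin 3) (hf : ContDiff ℝ (⊤ : ℕ∞) f)
    (hc : HasCompactSupport f) (hg : ContDiff ℝ (⊤ : ℕ∞) g) :
    Integrable (fun x => f x * pd i g x) ∧ Integrable (fun x => pd i f x * g x) ∧
      ∫ x, f x * pd i g x = -∫ x, pd i f x * g x := by
  have hc' : HasCompactSupport (pd i f) := hc.fderiv_apply (𝕜 := ℝ) _
  have h1 : Integrable (fun x => f x * pd i g x) :=
    (hf.continuous.mul (contDiff_pd i hg).continuous).integrable_of_hasCompactSupport hc.mul_right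
  have h2 : Integrable (fun x => pd i f x * g x) :=
    ((contDiff_pd i hf).continuous.mul hg.continuous).integrable_of_hasCompactSupport hc'.mul_right
  have h3 : Integrable (fun x => f x * g x) :=
    (hf.continuous.mul hg.continuous).integrable_of_hasCompactSupport hc.mul_right
  exact ⟨h1, h2, integral_mul_fderiv_eq_neg_fderiv_mul_of_integrable h2 h1 h3
    (fun x _ => hf.differentiable (by simp) x) (fun x _ => hg.differentiable (by simp) x)⟩

/-- The smooth radial cutoff equal to `1` for `‖x‖² ≤ a` and to `0` for `‖x‖² ≥ a + 1`. -/
noncomputable def radialCutoff (a : ℝ) (x : Slice) : ℝ := Real.smoothTransition (a + 1 - ‖x‖ ^ 2)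

theorem contDiff_radialCutoff (a : ℝ) : ContDiff ℝ (⊤ : ℕ∞) (radialCutoff a) :=
  Real.smoothTransition.contDiff.comp (contDiff_const.sub (contDiff_norm_sq ℝ))

theorem hasCompactSupport_radialCutoff (a : ℝ) : HasCompactSupport (radialCutoff a) := by
  refine HasCompactSupport.of_support_subset_isCompact
    (isCompact_closedBall (0 : Slice) (|a| + 1)) fun x hx => ?_
  by_contra h
  refine hx (Real.smoothTransition.zero_of_nonpos ?_)
  rw [mem_closedBall_zero_iff, not_le] at h
  nlinarith [le_abs_self a, abs_nonneg a]

theorem pd_radialCutoff (a : ℝ) (i : Fin 3) (x : Slice) :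
    pd i (radialCutoff a) x = -(2 * deriv Real.smoothTransition (a + 1 - ‖x‖ ^ 2) * x i) := by
  have h1 : HasDerivAt Real.smoothTransition (deriv Real.smoothTransition (a + 1 - ‖x‖ ^ 2))
      (a + 1 - ‖x‖ ^ 2) :=
    ((Real.smoothTransition.contDiff (n := 1)).differentiable (by simp) _).hasDerivAt
  have h2 : HasFDerivAt (fun y : Slice => a + 1 - ‖y‖ ^ 2) (-(2 • innerSL ℝ x)) x :=
    (hasStrictFDerivAt_norm_sq x).hasFDerivAt.const_sub (a + 1)
  have h3 : fderiv ℝ (radialCutoff a) x = _ := (h1.comp_hasFDerivAt x h2).fderiv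
  simp [pd, h3, EuclideanSpace.inner_single_right]
  ring

theorem deriv_smoothTransition_eq_zero_of_one_le {t : ℝ} (ht : 1 ≤ t) :
    deriv Real.smoothTransition t = 0 :=
  IsLocalMax.deriv_eq_zero (Filter.Eventually.of_forall fun s => by
    rw [Real.smoothTransition.one_of_one_le ht]
    exact Real.smoothTransition.le_one s)

theorem exists_deriv_smoothTransition_ne_zero :
    ∃ t ∈ Set.Ioo (0 : ℝ) 1, deriv Real.smoothTransition t ≠ 0 := by
  obtain ⟨t, ht, h⟩ := exists_deriv_eq_slope Real.smoothTransition (zero_lt_one' ℝ)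
    Real.smoothTransition.continuous.continuousOn
    ((Real.smoothTransition.contDiff (n := 1)).differentiable (by simp)).differentiableOn
  exact ⟨t, ht, by simp [h]⟩

/-- A smooth vector field with nonnegative divergence which does not point outwards far away is
divergence free, and is tangential to some distant sphere at some point of it. -/
theorem div_eq_zero_of_inward {Y : Fin 3 → Slice → ℝ} (hY : ∀ i, ContDiff ℝ (⊤ : ℕ∞) (Y i))
    (hdiv : ∀ x, 0 ≤ ∑ i, pd i (Y i) x) {R : ℝ} (hR : 0 ≤ R)
    (hin : ∀ x : Slice, R ≤ ‖x‖ → ∑ i, x i * Y i x ≤ 0) :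
    (∀ x, ∑ i, pd i (Y i) x = 0) ∧ ∃ x : Slice, R < ‖x‖ ∧ ∑ i, x i * Y i x = 0 := by
  have key (a : ℝ) (ha : R ^ 2 ≤ a) (x : Slice) :
      radialCutoff a x * ∑ i, pd i (Y i) x = 0 ∧
        deriv Real.smoothTransition (a + 1 - ‖x‖ ^ 2) * ∑ i, x i * Y i x = 0 := by
    have hφ := contDiff_radialCutoff a
    have hφc := hasCompactSupport_radialCutoff a
    have h1 (y : Slice) : 0 ≤ radialCutoff a y * ∑ i, pd i (Y i) y :=
      mul_nonneg (Real.smoothTransition.nonneg _) (hdiv y)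
    have h2 (y : Slice) :
        deriv Real.smoothTransition (a + 1 - ‖y‖ ^ 2) * ∑ i, y i * Y i y ≤ 0 := by
      by_cases hy : R ≤ ‖y‖
      · exact mul_nonpos_of_nonneg_of_nonpos Real.smoothTransition.monotone.deriv_nonneg (hin y hy)
      · rw [deriv_smoothTransition_eq_zero_of_one_le, zero_mul]
        nlinarith [norm_nonneg y]
    -- `F` is the divergence of the cutoff field, so its integral is zero; it is also a sum of two
    -- nonnegative terms, so both vanish identically.
    let F : Slice → ℝ := fun y => ∑ i, (radialCutoff a y * pd i (Y i) y +
      pd i (radialCutoff a) y * Y i y)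
    have hF (y : Slice) : F y = radialCutoff a y * ∑ i, pd i (Y i) y -
        2 * (deriv Real.smoothTransition (a + 1 - ‖y‖ ^ 2) * ∑ i, y i * Y i y) := by
      simp only [F, pd_radialCutoff, Fin.sum_univ_three]
      ring
    have hFc : Continuous F := by
      refine continuous_finsetSum _ fun i _ => ?_
      exact (hφ.continuous.mul (contDiff_pd i (hY i)).continuous).add
        ((contDiff_pd i hφ).continuous.mul (hY i).continuous)
    have hFi (i : Fin 3) : Integrable (fun y => radialCutoff a y * pd i (Y i) y +
        pd i (radialCutoff a) y * Y i y) :=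
      (integral_mul_pd i hφ hφc (hY i)).1.add (integral_mul_pd i hφ hφc (hY i)).2.1
    have hint : ∫ y, F y = 0 := by
      rw [integral_finsetSum _ fun i _ => hFi i]
      refine Finset.sum_eq_zero fun i _ => ?_
      obtain ⟨i1, i2, i3⟩ := integral_mul_pd i hφ hφc (hY i)
      rw [integral_add i1 i2, i3]
      ring
    have hF0 (y : Slice) : 0 ≤ F y := by
      rw [hF]
      linarith [h1 y, h2 y]
    have hzero : F = 0 := by
      have := (integral_eq_zero_iff_of_nonneg hF0 (integrable_finsetSum _ fun i _ => hFi i)).1 hint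
      exact (hFc.ae_eq_iff_eq volume continuous_const).1 this
    have := hF x
    rw [hzero, Pi.zero_apply] at this
    constructor <;> linarith [h1 x, h2 x]
  constructor
  · intro x
    have h := (key (R ^ 2 + ‖x‖ ^ 2) (by nlinarith [norm_nonneg x]) x).1
    refine (mul_eq_zero.1 h).resolve_left ?_
    rw [radialCutoff, Real.smoothTransition.one_of_one_le]
    · simp
    · nlinarith
  · obtain ⟨t, ⟨ht0, ht1⟩, ht⟩ := exists_deriv_smoothTransition_ne_zero
    have hn : ‖(EuclideanSpace.single 0 (Real.sqrt (R ^ 2 + 1 - t)) : Slice)‖ =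
        Real.sqrt (R ^ 2 + 1 - t) := by
      simp [abs_of_nonneg (Real.sqrt_nonneg _)]
    -- At this radius the cutoff for `a = R²` is evaluated at `t`, where its derivative is nonzero;
    -- `t < 1` puts the point beyond `R`.
    refine ⟨EuclideanSpace.single 0 (Real.sqrt (R ^ 2 + 1 - t)), ?_, ?_⟩
    · rw [hn]
      exact Real.lt_sqrt_of_sq_lt (by linarith)
    · have h := (key (R ^ 2) le_rfl (EuclideanSpace.single 0 (Real.sqrt (R ^ 2 + 1 - t)))).2
      refine (mul_eq_zero.1 h).resolve_left ?_
      rw [hn, Real.sq_sqrt (by nlinarith [sq_nonneg R])]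
      simpa using ht

/-! ### Divergence-free tensors -/

theorem sum_pd_contract {A : Fin 3 → Fin 3 → Slice → ℝ} {V : Fin 3 → Slice → ℝ}
    (hA : ∀ i j, ContDiff ℝ (⊤ : ℕ∞) (A i j)) (hV : ∀ j, ContDiff ℝ (⊤ : ℕ∞) (V j))
    (hdiv : ∀ j x, ∑ i, pd i (A i j) x = 0) (x : Slice) :
    ∑ i, pd i (fun y => ∑ j, A i j y * V j y) x = ∑ i, ∑ j, A i j x * pd i (V j) x := by
  have dA (i j) : DifferentiableAt ℝ (A i j) x := (hA i j).differentiable (by simp) x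
  have dV (j) : DifferentiableAt ℝ (V j) x := (hV j).differentiable (by simp) x
  have h (i) : pd i (fun y => ∑ j, A i j y * V j y) x =
      ∑ j, (pd i (A i j) x * V j x + A i j x * pd i (V j) x) := by
    rw [pd_sum _ _ (F := fun j y => A i j y * V j y) fun j _ => (dA i j).mul (dV j)]
    exact Finset.sum_congr rfl fun j _ => pd_mul i (dA i j) (dV j)
  have h0 := hdiv 0 x
  have h1 := hdiv 1 x
  have h2 := hdiv 2 x
  simp only [h]
  simp only [Fin.sum_univ_three] at *
  linear_combination V 0 x * h0 + V 1 x * h1 + V 2 x * h2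

/-- The divergence-free tensor `K δ_ij - K_ij`, where `K_ij = (ω_{i,j} + ω_{j,i}) / 2η`. -/
noncomputable def momentumTensor (ω : Slice → Slice) (η : Slice → ℝ) (i j : Fin 3) (x : Slice) : ℝ :=
  ((if i = j then 1 else 0) * divergence ω x - 1 / 2 * (dcomp ω i j x + dcomp ω j i x)) / η x

/-- The identically divergence-free tensor `(∇ · ω) δ_ij - ω_{i,j}` (divergence in `i`). -/
noncomputable def gradientTensor (ω : Slice → Slice) (i j : Fin 3) (x : Slice) : ℝ :=
  (if i = j then 1 else 0) * divergence ω x - dcomp ω i j x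

section Regularity

variable {ω : Slice → Slice} {η : Slice → ℝ}

theorem contDiff_comp (hω : ContDiff ℝ (⊤ : ℕ∞) ω) (i : Fin 3) : ContDiff ℝ (⊤ : ℕ∞) (fun y => ω y i) :=
  contDiff_euclidean.1 hω i

theorem contDiff_dcomp (hω : ContDiff ℝ (⊤ : ℕ∞) ω) (i j : Fin 3) : ContDiff ℝ (⊤ : ℕ∞) (dcomp ω i j) :=
  contDiff_pd j (contDiff_comp hω i)

theorem contDiff_divergence (hω : ContDiff ℝ (⊤ : ℕ∞) ω) : ContDiff ℝ (⊤ : ℕ∞) (divergence ω) :=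
  ContDiff.sum fun i _ => contDiff_dcomp hω i i

theorem contDiff_gradientTensor (hω : ContDiff ℝ (⊤ : ℕ∞) ω) (i j : Fin 3) :
    ContDiff ℝ (⊤ : ℕ∞) (gradientTensor ω i j) :=
  (contDiff_const.mul (contDiff_divergence hω)).sub (contDiff_dcomp hω i j)

theorem contDiff_momentumTensor (hω : ContDiff ℝ (⊤ : ℕ∞) ω) (hη : ContDiff ℝ (⊤ : ℕ∞) η) (h0 : ∀ x, 0 < η x)
    (i j : Fin 3) : ContDiff ℝ (⊤ : ℕ∞) (momentumTensor ω η i j) :=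
  ((contDiff_const.mul (contDiff_divergence hω)).sub (contDiff_const.mul
    ((contDiff_dcomp hω i j).add (contDiff_dcomp hω j i)))).div hη fun x => (h0 x).ne'

theorem pd_divergence (hω : ContDiff ℝ (⊤ : ℕ∞) ω) (j : Fin 3) (x : Slice) :
    pd j (divergence ω) x = ∑ i, pd i (dcomp ω i j) x := by
  have h : pd j (divergence ω) x = ∑ i, pd j (dcomp ω i i) x :=
    pd_sum _ _ fun i _ => (contDiff_dcomp hω i i).differentiable (by simp) x
  rw [h]
  exact Finset.sum_congr rfl fun i _ => pd_comm j i (contDiff_comp hω i)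

theorem sum_pd_ite (f : Slice → ℝ) (j : Fin 3) (x : Slice) :
    ∑ i, (if i = j then (1 : ℝ) else 0) * pd i f x = pd j f x := by
  simp

/-- Symmetry of second derivatives; no field equation enters. -/
theorem div_gradientTensor (hω : ContDiff ℝ (⊤ : ℕ∞) ω) (j : Fin 3) (x : Slice) :
    ∑ i, pd i (gradientTensor ω i j) x = 0 := by
  have dd := (contDiff_divergence hω).differentiable (by simp) x
  have dD (i j) := (contDiff_dcomp hω i j).differentiable (by simp) x
  have h (i) : pd i (gradientTensor ω i j) x =
      (if i = j then 1 else 0) * pd i (divergence ω) x - pd i (dcomp ω i j) x := by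
    unfold gradientTensor
    rw [pd_sub i (dd.const_mul _) (dD i j), pd_const_mul i _ dd]
  rw [Finset.sum_congr rfl fun i _ => h i, Finset.sum_sub_distrib, sum_pd_ite, pd_divergence hω,
    sub_self]

/-- This is the vacuum momentum equation itself, up to the factor `-1/2`. -/
theorem div_momentumTensor {Λ : ℝ} (hs : IsVacuumSolution Λ ω η) (j : Fin 3) (x : Slice) :
    ∑ i, pd i (momentumTensor ω η i j) x = 0 := by
  have hω := hs.smooth_omega
  have h0 := (hs.eta_pos x).ne'
  have dη := hs.smooth_eta.differentiable (by simp) x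
  have dd := (contDiff_divergence hω).differentiable (by simp) x
  have dD (i j) := (contDiff_dcomp hω i j).differentiable (by simp) x
  have h (i) : pd i (momentumTensor ω η i j) x =
      (((if i = j then 1 else 0) * pd i (divergence ω) x -
        1 / 2 * (pd i (dcomp ω i j) x + pd i (dcomp ω j i) x)) * η x -
        ((if i = j then 1 else 0) * divergence ω x - 1 / 2 * (dcomp ω i j x + dcomp ω j i x))
          * pd i η x) / η x ^ 2 := by
    unfold momentumTensor
    rw [pd_div i _ dη h0, pd_sub i (dd.const_mul _), pd_const_mul i _ dd, pd_const_mul,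
      pd_add i (dD i j) (dD j i)]
    · exact (dD i j).add (dD j i)
    · exact ((dD i j).add (dD j i)).const_mul _
    · exact (dd.const_mul _).sub (((dD i j).add (dD j i)).const_mul _)
  have hm := hs.momentum x j
  have hp := pd_divergence hω j x
  simp only [h, ← Finset.sum_div]
  rw [div_eq_zero_iff]
  left
  have e1 := sum_pd_ite (divergence ω) j x
  have e2 := sum_pd_ite η j x
  simp only [laplacianComp, Fin.sum_univ_three, PiLp.zero_apply, mul_zero] at *
  field_simp at hm
  linear_combination η x * e1 - divergence ω x * e2 - η x / 2 * hp.symm + hm / 2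

end Regularity

/-! ### Radial fields and the exterior solution -/

theorem norm_sq_eq_sum (x : Slice) : x 0 * x 0 + x 1 * x 1 + x 2 * x 2 = ‖x‖ ^ 2 := by
  rw [EuclideanSpace.real_norm_sq_eq, Fin.sum_univ_three]
  ring

theorem hasFDerivAt_comp_norm {F : ℝ → ℝ} {d : ℝ} {x : Slice} (hx : x ≠ 0)
    (hF : HasDerivAt F d ‖x‖) :
    HasFDerivAt (fun y : Slice => F ‖y‖) ((d / ‖x‖) • innerSL ℝ x) x := by
  have hn : ‖x‖ ≠ 0 := norm_ne_zero_iff.2 hx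
  have h1 : HasFDerivAt (fun y : Slice => Real.sqrt (‖y‖ ^ 2)) _ x :=
    (hasStrictFDerivAt_norm_sq x).hasFDerivAt.sqrt (pow_ne_zero 2 hn)
  simp only [Real.sqrt_sq (norm_nonneg _)] at h1
  refine (hF.comp_hasFDerivAt x h1).congr_fderiv ?_
  ext v
  simp
  field_simp

theorem pd_comp_norm {F : ℝ → ℝ} {d : ℝ} {x : Slice} (hx : x ≠ 0) (hF : HasDerivAt F d ‖x‖)
    (j : Fin 3) : pd j (fun y => F ‖y‖) x = d / ‖x‖ * x j := by
  simp [pd, (hasFDerivAt_comp_norm hx hF).fderiv, EuclideanSpace.inner_single_right]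

theorem dcomp_radial {ω : Slice → Slice} {W : ℝ → ℝ} {d : ℝ} {U : Set Slice} (hU : IsOpen U)
    (hω : ∀ y ∈ U, ∀ i, ω y i = W ‖y‖ * y i) {x : Slice} (hxU : x ∈ U) (hx : x ≠ 0)
    (hW : HasDerivAt W d ‖x‖) (i j : Fin 3) :
    dcomp ω i j x = W ‖x‖ * (if i = j then 1 else 0) + d / ‖x‖ * x i * x j := by
  have hc : DifferentiableAt ℝ (fun y : Slice => y i) x :=
    (contDiff_comp (ω := fun y => y) contDiff_id i).differentiable (by simp) x
  rw [dcomp, pd_congr hU hxU (g := fun y => W ‖y‖ * y i) (fun y hy => hω y hy i),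
    pd_mul j (hasFDerivAt_comp_norm hx hW).differentiableAt hc, pd_comp_norm hx hW, pd_coord]
  simp only [eq_comm (a := j)]
  ring

/-- A vacuum solution which is spherically symmetric at infinity has constant lapse `c` there, and
`ω = W(r) r dr` where `r³ (W² - c² Λ/3)` is a constant, proportional to the mass. -/
theorem exists_exterior_form {Λ : ℝ} (hΛ : 0 < Λ) {ω : Slice → Slice} {η : Slice → ℝ}
    (hs : IsVacuumSolution Λ ω η) (hsym : SphericallySymmetricAtInfinity ω η) :
    ∃ R c C : ℝ, 0 < R ∧ 0 < c ∧ ∃ W V : ℝ → ℝ, ∀ x : Slice, R < ‖x‖ →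
      (∀ i, ω x i = W ‖x‖ * x i) ∧ η x = c ∧
      (∀ i j, dcomp ω i j x = W ‖x‖ * (if i = j then 1 else 0) + V ‖x‖ * x i * x j) ∧
      ‖x‖ ^ 3 * (W ‖x‖ ^ 2 - c ^ 2 * (Λ / 3)) = C := by
  obtain ⟨R, hR, w, h, hwh⟩ := hsym
  -- No regularity is assumed of `w` and `h`; restricting `ω` and `η` to a ray gives smooth
  -- profiles.
  let e : ℝ → Slice := fun s => s • EuclideanSpace.single 0 1
  have he (s : ℝ) (hs : R < s) : ‖e s‖ = s := by
    simp [e, norm_smul, abs_of_pos (hR.trans hs)]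
  have he0 (s : ℝ) : e s 0 = s := by simp [e]
  have hes : ContDiff ℝ (⊤ : ℕ∞) e := contDiff_id.smul contDiff_const
  let W : ℝ → ℝ := fun s => ω (e s) 0 / s
  let H : ℝ → ℝ := fun s => η (e s)
  have hW (s : ℝ) (h0 : R < s) : HasDerivAt W (deriv W s) s := by
    have : DifferentiableAt ℝ (fun s => ω (e s) 0) s :=
      (((contDiff_comp hs.smooth_omega 0).comp hes).differentiable (by simp)) s
    exact (this.div differentiableAt_id (hR.trans h0).ne').hasDerivAt
  have hH (s : ℝ) : HasDerivAt H (deriv H s) s :=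
    (((hs.smooth_eta.comp hes).differentiable (by simp)) s).hasDerivAt
  let U : Set Slice := {x | R < ‖x‖}
  have hU : IsOpen U := isOpen_lt continuous_const continuous_norm
  have hx0 (x : Slice) (hx : x ∈ U) : x ≠ 0 := norm_pos_iff.1 (hR.trans hx)
  have hωU (x : Slice) (hx : x ∈ U) (i : Fin 3) : ω x i = W ‖x‖ * x i := by
    have h1 := (hwh x (le_of_lt hx)).1
    have h2 := (hwh (e ‖x‖) (by rw [he _ hx]; exact le_of_lt hx)).1
    have hn := norm_ne_zero_iff.2 (hx0 x hx)
    have h3 : W ‖x‖ = w ‖x‖ * ‖x‖⁻¹ := by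
      simp only [W, h2, he _ hx, PiLp.smul_apply, he0, smul_eq_mul]
      field_simp
    rw [h1, h3]
    simp only [PiLp.smul_apply, smul_eq_mul]
    ring
  have hηU (x : Slice) (hx : x ∈ U) : η x = H ‖x‖ := by
    rw [(hwh x (le_of_lt hx)).2]
    simp only [H]
    rw [(hwh (e ‖x‖) (by rw [he _ hx]; exact le_of_lt hx)).2, he _ hx]
  have hD (x : Slice) (hx : x ∈ U) (i j : Fin 3) := dcomp_radial hU hωU hx (hx0 x hx) (hW _ hx) i j
  have hdη (x : Slice) (hx : x ∈ U) (j : Fin 3) : pd j η x = deriv H ‖x‖ / ‖x‖ * x j := by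
    rw [pd_congr hU hx hηU, pd_comp_norm (hx0 x hx) (hH _)]
  have henergy (x : Slice) (hx : x ∈ U) :
      6 * W ‖x‖ ^ 2 + 4 * ‖x‖ * W ‖x‖ * deriv W ‖x‖ = 2 * Λ * H ‖x‖ ^ 2 := by
    have hE := hs.energy x
    have hp := (hs.eta_pos x).ne'
    have hn := norm_ne_zero_iff.2 (hx0 x hx)
    have hr := norm_sq_eq_sum x
    rw [← hηU x hx]
    simp only [divergence, Fin.sum_univ_three, hD x hx] at hE
    simp only [Fin.isValue, reduceIte, mul_zero, add_zero, mul_one, Fin.reduceEq, zero_add] at hE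
    have hP : deriv W ‖x‖ / ‖x‖ * ‖x‖ ^ 2 = ‖x‖ * deriv W ‖x‖ := by field_simp
    generalize deriv W ‖x‖ / ‖x‖ = P at hE hP
    rw [one_div, inv_mul_eq_div, eq_div_iff (pow_ne_zero 2 hp)] at hE
    linear_combination -hE - 4 * W ‖x‖ * hP - 4 * W ‖x‖ * P * hr
  have hmom (x : Slice) (hx : x ∈ U) (i : Fin 3) :
      W ‖x‖ * deriv H ‖x‖ * x i = 0 := by
    have hM := hs.momentum x i
    have hp := (hs.eta_pos x).ne'
    have hn := norm_ne_zero_iff.2 (hx0 x hx)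
    have hr := norm_sq_eq_sum x
    -- A radial one-form is closed, so the second-order terms of the momentum equation cancel.
    have hlap : laplacianComp ω i x = pd i (divergence ω) x := by
      rw [pd_divergence hs.smooth_omega]
      refine Finset.sum_congr rfl fun j _ => pd_congr hU hx (fun y hy => ?_) j
      rw [hD y hy, hD y hy]
      simp only [eq_comm (a := i)]
      ring
    rw [hlap, sub_self] at hM
    simp only [divergence, Fin.sum_univ_three, hD x hx, hdη x hx] at hM
    have hP : deriv W ‖x‖ / ‖x‖ * ‖x‖ ^ 2 = ‖x‖ * deriv W ‖x‖ := by field_simp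
    have hQ : deriv H ‖x‖ / ‖x‖ * ‖x‖ = deriv H ‖x‖ := by field_simp
    generalize deriv W ‖x‖ / ‖x‖ = P at hM hP
    generalize deriv H ‖x‖ / ‖x‖ = Q at hM hQ
    have hM' : W ‖x‖ * Q * x i = 0 := by
      obtain rfl | rfl | rfl : i = 0 ∨ i = 1 ∨ i = 2 := by fin_cases i <;> simp
      all_goals
        simp at hM
        field_simp at hM
        linear_combination -hM / 4
    linear_combination ‖x‖ * hM' - W ‖x‖ * x i * hQ
  have hW0 (s : ℝ) (h0 : R < s) : W s ≠ 0 := by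
    intro hW0
    have h1 := henergy (e s) (by simpa [U, he s h0] using h0)
    rw [he s h0, hW0] at h1
    have h2 : 0 < H s := hs.eta_pos _
    have : 0 < 2 * Λ * H s ^ 2 := by positivity
    linarith
  have hH0 (s : ℝ) (h0 : R < s) : deriv H s = 0 := by
    have h1 := hmom (e s) (by simpa [U, he s h0] using h0) 0
    rw [he s h0, he0] at h1
    simpa [hW0 s h0, (hR.trans h0).ne'] using h1
  have hHc (s : ℝ) (h0 : R < s) : H s = H (R + 1) :=
    isOpen_Ioi.is_const_of_deriv_eq_zero (s := Set.Ioi R) isPreconnected_Ioi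
      (fun t _ => (hH t).differentiableAt.differentiableWithinAt) (fun t ht => hH0 t ht) h0
      (by simp)
  let E : ℝ → ℝ := fun s => s ^ 3 * (W s ^ 2 - H (R + 1) ^ 2 * (Λ / 3))
  have hE (s : ℝ) (h0 : R < s) : HasDerivAt E 0 s := by
    have h1 := (hasDerivAt_pow 3 s).mul (((hW s h0).pow 2).sub_const (H (R + 1) ^ 2 * (Λ / 3)))
    have h2 := henergy (e s) (by simpa [U, he s h0] using h0)
    rw [he s h0, hHc s h0] at h2
    refine h1.congr_deriv ?_
    -- The energy equation is `6W² + 4sWW' = 2Λη²`; multiplied by `s²/2` it says that `E' = 0`.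
    simp
    linear_combination s ^ 2 / 2 * h2
  have hEc (s : ℝ) (h0 : R < s) : E s = E (R + 1) :=
    isOpen_Ioi.is_const_of_deriv_eq_zero (s := Set.Ioi R) isPreconnected_Ioi
      (fun t ht => (hE t ht).differentiableAt.differentiableWithinAt)
      (fun t ht => (hE t ht).deriv) h0 (by simp)
  refine ⟨R, H (R + 1), E (R + 1), hR, hs.eta_pos _, W, fun s => deriv W s / s, fun x hx =>
    ⟨hωU x hx, ?_, hD x hx, hEc _ hx⟩⟩
  rw [hηU x hx, hHc _ hx]

/-! ### The two flux fields -/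

section Identities

variable {Λ : ℝ} {ω : Slice → Slice} {η : Slice → ℝ}

theorem IsVacuumSolution.vacuum_energy (hs : IsVacuumSolution Λ ω η) (x : Slice) :
    divergence ω x ^ 2 - 1 / 4 * ∑ i, ∑ j, (dcomp ω i j x + dcomp ω j i x) ^ 2 =
      2 * Λ * η x ^ 2 := by
  have h := hs.energy x
  rw [one_div, inv_mul_eq_div, eq_div_iff (pow_ne_zero 2 (hs.eta_pos x).ne')] at h
  linear_combination -h

/-- Cauchy–Schwarz: the symmetric part of `∂ω` has squared norm at least a third of its squared
trace. -/
theorem IsVacuumSolution.sq_divergence_ge (hs : IsVacuumSolution Λ ω η) (x : Slice) :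
    3 * Λ * η x ^ 2 ≤ divergence ω x ^ 2 := by
  have h := hs.vacuum_energy x
  simp only [divergence, Fin.sum_univ_three] at *
  nlinarith [sq_nonneg (dcomp ω 0 0 x - dcomp ω 1 1 x), sq_nonneg (dcomp ω 0 0 x - dcomp ω 2 2 x),
    sq_nonneg (dcomp ω 1 1 x - dcomp ω 2 2 x), sq_nonneg (dcomp ω 0 1 x + dcomp ω 1 0 x),
    sq_nonneg (dcomp ω 0 2 x + dcomp ω 2 0 x), sq_nonneg (dcomp ω 1 2 x + dcomp ω 2 1 x)]

theorem contDiff_coord (i : Fin 3) : ContDiff ℝ (⊤ : ℕ∞) (fun y : Slice => y i) :=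
  contDiff_comp (ω := fun y => y) contDiff_id i

/-- The flux field `(K δ_ij - K_ij) x_j - 2a x_i`. -/
noncomputable def curvatureField (ω : Slice → Slice) (η : Slice → ℝ) (a : ℝ) (i : Fin 3)
    (x : Slice) : ℝ :=
  ∑ j, momentumTensor ω η i j x * x j - 2 * a * x i

/-- The flux field `((∇ · ω) δ_ij - ω_{i,j}) ω_j - 2c (K δ_ij - K_ij) ω_j + 2 c² b x_i`. -/
noncomputable def lapseField (ω : Slice → Slice) (η : Slice → ℝ) (b c : ℝ) (i : Fin 3)
    (x : Slice) : ℝ :=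
  ∑ j, (gradientTensor ω i j x - 2 * c * momentumTensor ω η i j x) * ω x j + 2 * c ^ 2 * b * x i

theorem contDiff_curvatureField (hs : IsVacuumSolution Λ ω η) (a : ℝ) (i : Fin 3) :
    ContDiff ℝ (⊤ : ℕ∞) (curvatureField ω η a i) :=
  (ContDiff.sum fun j _ => (contDiff_momentumTensor hs.smooth_omega hs.smooth_eta hs.eta_pos i j).mul
    (contDiff_coord j)).sub (contDiff_const.mul (contDiff_coord i))

theorem contDiff_lapseField (hs : IsVacuumSolution Λ ω η) (b c : ℝ) (i : Fin 3) :
    ContDiff ℝ (⊤ : ℕ∞) (lapseField ω η b c i) :=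
  (ContDiff.sum fun j _ => ((contDiff_gradientTensor hs.smooth_omega i j).sub (contDiff_const.mul
    (contDiff_momentumTensor hs.smooth_omega hs.smooth_eta hs.eta_pos i j))).mul
    (contDiff_comp hs.smooth_omega j)).add (contDiff_const.mul (contDiff_coord i))

/-- Only the trace `3K - K = 2K` of the tensor survives, because `∂_i x_j = δ_ij`. -/
theorem div_curvatureField (hs : IsVacuumSolution Λ ω η) (a : ℝ) (x : Slice) :
    ∑ i, pd i (curvatureField ω η a i) x = 2 * (divergence ω x / η x - 3 * a) := by
  have hT (i j) := contDiff_momentumTensor hs.smooth_omega hs.smooth_eta hs.eta_pos i j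
  have hc (i) : DifferentiableAt ℝ (fun y : Slice => y i) x :=
    (contDiff_coord i).differentiable (by simp) x
  have hsum (i) : DifferentiableAt ℝ (fun y => ∑ j, momentumTensor ω η i j y * y j) x :=
    (ContDiff.sum fun j _ => (hT i j).mul (contDiff_coord j)).differentiable (by simp) x
  have h (i) : pd i (curvatureField ω η a i) x =
      pd i (fun y => ∑ j, momentumTensor ω η i j y * y j) x - 2 * a := by
    unfold curvatureField
    rw [pd_sub i (hsum i) ((hc i).const_mul _), pd_const_mul i _ (hc i), pd_coord]
    simp
  have h2 := sum_pd_contract hT contDiff_coord (div_momentumTensor hs) x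
  simp only [h, Finset.sum_sub_distrib, h2, pd_coord]
  simp [Fin.sum_univ_three, momentumTensor, divergence]
  ring

/-- By the energy equation, contraction of `∂ω` with the gradient tensor gives `2Λη²` plus the
antisymmetric square, and with the momentum tensor `2Λη`. The position term adds `2Λc²`, completing
the square. -/
theorem div_lapseField (hs : IsVacuumSolution Λ ω η) (c : ℝ) (x : Slice) :
    ∑ i, pd i (lapseField ω η (Λ / 3) c i) x =
      2 * Λ * (η x - c) ^ 2 + 1 / 4 * ∑ i, ∑ j, (dcomp ω i j x - dcomp ω j i x) ^ 2 := by
  have hN (i j) := contDiff_gradientTensor hs.smooth_omega i j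
  have hT (i j) := contDiff_momentumTensor hs.smooth_omega hs.smooth_eta hs.eta_pos i j
  have hω (j) := contDiff_comp hs.smooth_omega j
  have hc (i) : DifferentiableAt ℝ (fun y : Slice => y i) x :=
    (contDiff_coord i).differentiable (by simp) x
  let A : Fin 3 → Fin 3 → Slice → ℝ :=
    fun i j y => gradientTensor ω i j y - 2 * c * momentumTensor ω η i j y
  have hA (i j) : ContDiff ℝ (⊤ : ℕ∞) (A i j) := (hN i j).sub (contDiff_const.mul (hT i j))
  have hAdiv (j y) : ∑ i, pd i (A i j) y = 0 := by
    have dN (i) := (hN i j).differentiable (by simp) y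
    have dT (i) := (hT i j).differentiable (by simp) y
    have h (i) : pd i (A i j) y =
        pd i (gradientTensor ω i j) y - 2 * c * pd i (momentumTensor ω η i j) y := by
      rw [← pd_const_mul i _ (dT i), ← pd_sub i (dN i) ((dT i).const_mul _)]
    rw [Finset.sum_congr rfl fun i _ => h i, Finset.sum_sub_distrib, ← Finset.mul_sum,
      div_gradientTensor hs.smooth_omega, div_momentumTensor hs]
    simp
  have hsum (i) : DifferentiableAt ℝ (fun y => ∑ j, A i j y * ω y j) x :=
    (ContDiff.sum fun j _ => (hA i j).mul (hω j)).differentiable (by simp) x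
  have h (i) : pd i (lapseField ω η (Λ / 3) c i) x =
      pd i (fun y => ∑ j, A i j y * ω y j) x + 2 * c ^ 2 * (Λ / 3) := by
    unfold lapseField
    rw [pd_add i (hsum i) ((hc i).const_mul _), pd_const_mul i _ (hc i), pd_coord]
    simp
  have h2 := sum_pd_contract hA hω hAdiv x
  have h3 (i j) : pd i (fun y => ω y j) x = dcomp ω j i x := rfl
  have hE := hs.vacuum_energy x
  have h0 := (hs.eta_pos x).ne'
  simp only [h, Finset.sum_add_distrib, h2, h3]
  have hq : (divergence ω x ^ 2 - 1 / 4 * ∑ i, ∑ j, (dcomp ω i j x + dcomp ω j i x) ^ 2) / η x =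
      2 * Λ * η x := by
    rw [hE]
    field_simp
  simp only [Fin.sum_univ_three] at hE hq
  simp only [A, gradientTensor, momentumTensor, Fin.sum_univ_three, Fin.isValue, reduceIte,
    Fin.reduceEq]
  have hdiv : divergence ω x = dcomp ω 0 0 x + dcomp ω 1 1 x + dcomp ω 2 2 x := by
    simp [divergence, Fin.sum_univ_three]
  rw [hdiv] at hE hq ⊢
  rw [div_eq_mul_inv] at hq
  simp only [div_eq_mul_inv (b := η x)]
  linear_combination hE - 2 * c * hq

end Identities

/-! ### Radial flux at infinity -/

section Exterior

variable {ω : Slice → Slice} {η : Slice → ℝ} {c W V : ℝ} {x : Slice}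

/-- Subtracting from the trace removes the radial-radial entry, so `V` drops out and the sign
depends on `W` alone. -/
theorem radial_curvatureField (a : ℝ) (hη : η x = c)
    (hD : ∀ i j, dcomp ω i j x = W * (if i = j then 1 else 0) + V * x i * x j) :
    ∑ i, x i * curvatureField ω η a i x = 2 * (W / c - a) * ‖x‖ ^ 2 := by
  rw [← norm_sq_eq_sum]
  simp only [curvatureField, momentumTensor, divergence, Fin.sum_univ_three, hD, hη, Fin.isValue,
    reduceIte, Fin.reduceEq]
  ring

theorem radial_lapseField (b : ℝ) (hc : c ≠ 0) (hη : η x = c) (hω : ∀ i, ω x i = W * x i)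
    (hD : ∀ i j, dcomp ω i j x = W * (if i = j then 1 else 0) + V * x i * x j) :
    ∑ i, x i * lapseField ω η b c i x = 2 * (c ^ 2 * b - W ^ 2) * ‖x‖ ^ 2 := by
  rw [← norm_sq_eq_sum]
  simp only [lapseField, gradientTensor, momentumTensor, divergence, Fin.sum_univ_three, hD, hη, hω,
    Fin.isValue, reduceIte, Fin.reduceEq]
  field_simp
  ring

end Exterior

/-! ### Rigidity -/

theorem omegaVac_coeff_sq {Λ : ℝ} (hΛ : 0 < Λ) : Real.sqrt (Λ / 3) ^ 2 = Λ / 3 :=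
  Real.sq_sqrt (by positivity)

/-- A one-form with `ω_{i,j} = a δ_ij` which is odd at some point is `a r dr`. -/
theorem eq_smul_of_dcomp {ω : Slice → Slice} (hω : ContDiff ℝ (⊤ : ℕ∞) ω) {a : ℝ}
    (hD : ∀ i j x, dcomp ω i j x = if i = j then a else 0) {p : Slice} (hp : ω (-p) = -ω p)
    (x : Slice) : ω x = a • x := by
  have key (i : Fin 3) (y z : Slice) : ω y i - a * y i = ω z i - a * z i := by
    have dω := (contDiff_comp hω i).differentiable (by simp)
    have dc := (contDiff_coord i).differentiable (by simp)
    refine is_const_of_fderiv_eq_zero (𝕜 := ℝ) (f := fun y : Slice => ω y i - a * y i)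
      (dω.sub (dc.const_mul a)) (fun q => fderiv_eq_zero_of_pd fun j => ?_) y z
    rw [pd_sub j (dω q) ((dc q).const_mul a), pd_const_mul j _ (dc q), pd_coord]
    have := hD i j q
    rw [dcomp] at this
    rw [this]
    simp [eq_comm]
  ext i
  have h1 := key i x p
  have h2 := key i (-p) p
  rw [hp] at h2
  simp only [PiLp.neg_apply, PiLp.smul_apply, smul_eq_mul] at *
  linarith

theorem sameUpToTimeRescaling_of_arrowOfTime {Λ : ℝ} (hΛ : 0 < Λ) {ω : Slice → Slice}
    {η : Slice → ℝ} (hs : IsVacuumSolution Λ ω η) (hsym : SphericallySymmetricAtInfinity ω η)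
    (harrow : ArrowOfTime ω η) :
    SameUpToTimeRescaling ω η (omegaVac Λ) etaVac := by
  obtain ⟨R, c, C, hR, hc, W, V, hext⟩ := exists_exterior_form hΛ hs hsym
  set l := Real.sqrt (Λ / 3)
  have hl2 : l ^ 2 = Λ / 3 := omegaVac_coeff_sq hΛ
  have hl0 : 0 < l := Real.sqrt_pos.2 (by positivity)
  -- The exterior form holds strictly beyond `R`, while the inward condition is needed on a closed
  -- exterior region; hence `R + 1`.
  have hR1 : 0 ≤ R + 1 := by linarith
  have curvature (hC : C ≤ 0) :
      (∀ x, divergence ω x / η x = 3 * l) ∧ C = 0 := by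
    have h := div_eq_zero_of_inward (contDiff_curvatureField hs l) (fun x => ?_) hR1
      fun x hx => ?_
    · constructor
      · intro x
        have := h.1 x
        rw [div_curvatureField hs] at this
        linarith
      · obtain ⟨x, hx, hx0⟩ := h.2
        obtain ⟨-, h2, h3, h4⟩ := hext x (by linarith)
        have hn : 0 < ‖x‖ := by linarith
        rw [radial_curvatureField l h2 h3] at hx0
        have hW : W ‖x‖ / c - l = 0 := by simpa [hn.ne'] using hx0
        rw [sub_eq_zero, div_eq_iff hc.ne'] at hW
        rw [← h4, hW, ← hl2]
        ring
    · rw [div_curvatureField hs]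
      have h1 : (3 * l) ^ 2 ≤ (divergence ω x / η x) ^ 2 := by
        rw [div_pow, le_div_iff₀ (by have := hs.eta_pos x; positivity), mul_pow, hl2]
        linarith [hs.sq_divergence_ge x]
      have h2 := abs_le_of_sq_le_sq' h1 (harrow x).le
      linarith [h2.2]
    · obtain ⟨-, h2, h3, h4⟩ := hext x (by linarith)
      have hn : 0 < ‖x‖ := by linarith
      rw [radial_curvatureField l h2 h3]
      have h5 : W ‖x‖ ^ 2 - c ^ 2 * (Λ / 3) ≤ 0 := by
        by_contra! h5
        have : 0 < ‖x‖ ^ 3 * (W ‖x‖ ^ 2 - c ^ 2 * (Λ / 3)) := by positivity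
        linarith
      have h6 : W ‖x‖ ≤ l * c :=
        (abs_le_of_sq_le_sq' (by rw [mul_pow, hl2]; linarith) (by positivity)).2
      have h7 : W ‖x‖ / c - l ≤ 0 := by
        rw [sub_nonpos, div_le_iff₀ hc]
        exact h6
      exact mul_nonpos_of_nonpos_of_nonneg (by linarith) (by positivity)
  have lapse (hC : 0 ≤ C) :
      (∀ x, η x = c ∧ ∀ i j, dcomp ω i j x = dcomp ω j i x) ∧ C = 0 := by
    have h := div_eq_zero_of_inward (contDiff_lapseField hs (Λ / 3) c) (fun x => ?_) hR1
      fun x hx => ?_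
    · constructor
      · intro x
        have hx := h.1 x
        rw [div_lapseField hs] at hx
        have hsq : 0 ≤ ∑ i, ∑ j, (dcomp ω i j x - dcomp ω j i x) ^ 2 := by positivity
        have hη2 : 0 ≤ 2 * Λ * (η x - c) ^ 2 := by positivity
        constructor
        · have : 2 * Λ * (η x - c) ^ 2 = 0 := by linarith
          have : η x - c = 0 := by simpa [hΛ.ne'] using this
          linarith
        · intro i j
          have h0 : ∑ i, ∑ j, (dcomp ω i j x - dcomp ω j i x) ^ 2 = 0 := by linarith
          rw [Finset.sum_eq_zero_iff_of_nonneg fun i _ => by positivity] at h0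
          have h1 := h0 i (Finset.mem_univ i)
          rw [Finset.sum_eq_zero_iff_of_nonneg fun i _ => by positivity] at h1
          have h2 := h1 j (Finset.mem_univ j)
          linarith [pow_eq_zero_iff two_ne_zero |>.1 h2]
      · obtain ⟨x, hx, hx0⟩ := h.2
        obtain ⟨h1, h2, h3, h4⟩ := hext x (by linarith)
        have hn : 0 < ‖x‖ := by linarith
        rw [radial_lapseField _ hc.ne' h2 h1 h3] at hx0
        have hW : c ^ 2 * (Λ / 3) - W ‖x‖ ^ 2 = 0 := by
          rcases mul_eq_zero.1 hx0 with h | h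
          · linarith
          · exact absurd h (by positivity)
        rw [← h4]
        linear_combination -‖x‖ ^ 3 * hW
    · rw [div_lapseField hs]
      positivity
    · obtain ⟨h1, h2, h3, h4⟩ := hext x (by linarith)
      have hn : 0 < ‖x‖ := by linarith
      rw [radial_lapseField _ hc.ne' h2 h1 h3]
      have h5 : c ^ 2 * (Λ / 3) - W ‖x‖ ^ 2 ≤ 0 := by
        by_contra! h5
        have : 0 < ‖x‖ ^ 3 * (c ^ 2 * (Λ / 3) - W ‖x‖ ^ 2) := by positivity
        linarith
      exact mul_nonpos_of_nonpos_of_nonneg (by linarith) (by positivity)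
  have hC : C = 0 := (le_total C 0).elim (fun h => (curvature h).2) fun h => (lapse h).2
  have hK := (curvature hC.le).1
  have hη := (lapse hC.ge).1
  have hD (i j : Fin 3) (x : Slice) : dcomp ω i j x = if i = j then c * l else 0 := by
    have hE := hs.vacuum_energy x
    have hdiv := hK x
    rw [(hη x).1, div_eq_iff hc.ne'] at hdiv
    rw [(hη x).1, hdiv] at hE
    -- Expanding with `∇·ω = 3cl` and the energy equation gives `(3 - 6 + 3)c²l²`.
    have h0 : ∑ i, ∑ j, (dcomp ω i j x - if i = j then c * l else 0) ^ 2 = 0 := by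
      simp only [divergence, Fin.sum_univ_three, (hη x).2 1 0, (hη x).2 2 0, (hη x).2 2 1,
        Fin.isValue, reduceIte, Fin.reduceEq] at hdiv hE ⊢
      linear_combination -hE - 2 * c * l * hdiv + 6 * c ^ 2 * hl2
    rw [Finset.sum_eq_zero_iff_of_nonneg fun i _ => by positivity] at h0
    have h1 := h0 i (Finset.mem_univ i)
    rw [Finset.sum_eq_zero_iff_of_nonneg fun i _ => by positivity] at h1
    have h2 := h1 j (Finset.mem_univ j)
    linarith [pow_eq_zero_iff two_ne_zero |>.1 h2]
  refine ⟨c, hc, fun x => ⟨?_, by simp [etaVac, (hη x).1]⟩⟩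
  -- The exterior form is odd, which kills the constant of integration.
  have hp : R < ‖(EuclideanSpace.single 0 (R + 1) : Slice)‖ := by
    simp [abs_of_nonneg hR1]
  rw [eq_smul_of_dcomp hs.smooth_omega hD (p := EuclideanSpace.single 0 (R + 1)) _ x, omegaVac,
    smul_smul]
  ext i
  have h1 := (hext _ hp).1 i
  have h2 := (hext (-(EuclideanSpace.single 0 (R + 1) : Slice)) (by rwa [norm_neg])).1 i
  rw [norm_neg] at h2
  rw [h2, PiLp.neg_apply, PiLp.neg_apply, h1]
  ring

/-! ### Time reversal -/

section Reversal

variable {ω : Slice → Slice} {η : Slice → ℝ}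

theorem dcomp_neg (i j : Fin 3) : dcomp (-ω) i j = fun x => -dcomp ω i j x := by
  funext x
  exact pd_neg j

theorem divergence_neg : divergence (-ω) = fun x => -divergence ω x := by
  funext x
  simp [divergence, dcomp_neg]

theorem laplacianComp_neg (i : Fin 3) (x : Slice) :
    laplacianComp (-ω) i x = -laplacianComp ω i x := by
  simp [laplacianComp, dcomp_neg, pd_neg]

theorem IsVacuumSolution.neg {Λ : ℝ} (hs : IsVacuumSolution Λ ω η) : IsVacuumSolution Λ (-ω) η where
  smooth_omega := hs.smooth_omega.neg
  smooth_eta := hs.smooth_eta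
  eta_pos := hs.eta_pos
  energy x := by
    have h := hs.energy x
    simp only [divergence_neg, dcomp_neg, Fin.sum_univ_three] at h ⊢
    rw [h]
    ring
  momentum x i := by
    have h := hs.momentum x i
    simp only [divergence_neg, laplacianComp_neg, dcomp_neg, pd_neg, Fin.sum_univ_three,
      PiLp.zero_apply] at h ⊢
    linear_combination -h

theorem SphericallySymmetricAtInfinity.neg (h : SphericallySymmetricAtInfinity ω η) :
    SphericallySymmetricAtInfinity (-ω) η := by
  obtain ⟨R, hR, w, k, hwk⟩ := h
  refine ⟨R, hR, fun r => -w r, k, fun x hx => ⟨?_, (hwk x hx).2⟩⟩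
  rw [Pi.neg_apply, (hwk x hx).1, neg_smul]

/-- In a vacuum with `Λ > 0` the mean curvature has a constant sign. -/
theorem arrowOfTime_or_neg {Λ : ℝ} (hΛ : 0 < Λ) (hs : IsVacuumSolution Λ ω η) :
    ArrowOfTime ω η ∨ ArrowOfTime (-ω) η := by
  have hne (x : Slice) : divergence ω x ≠ 0 := by
    intro h0
    have h1 := hs.sq_divergence_ge x
    have h2 := hs.eta_pos x
    have : 0 < 3 * Λ * η x ^ 2 := by positivity
    rw [h0] at h1
    linarith
  have hcont := (contDiff_divergence hs.smooth_omega).continuous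
  -- Intermediate value theorem on the connected slice.
  have hall (x y : Slice) (hx : 0 < divergence ω x) : 0 < divergence ω y := by
    by_contra! hy
    obtain ⟨z, hz⟩ := mem_range_of_exists_le_of_exists_ge hcont ⟨y, hy⟩ ⟨x, hx.le⟩
    exact hne z hz
  rcases lt_or_gt_of_ne (hne 0) with h | h
  · refine Or.inr fun x => div_pos ?_ (hs.eta_pos x)
    rw [divergence_neg]
    have : ¬ 0 < divergence ω x := fun hx => (hall x 0 hx).not_gt h
    have := lt_of_le_of_ne (not_lt.1 this) (hne x)
    linarith
  · exact Or.inl fun x => div_pos (hall 0 x h) (hs.eta_pos x)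

end Reversal

/-! ### The model solution -/

theorem dcomp_omegaVac (Λ : ℝ) (i j : Fin 3) :
    dcomp (omegaVac Λ) i j = fun _ => Real.sqrt (Λ / 3) * if j = i then 1 else 0 := by
  funext x
  have h : (fun y => omegaVac Λ y i) = fun y : Slice => Real.sqrt (Λ / 3) * y i := by
    funext y
    simp [omegaVac]
  rw [dcomp, h, pd_const_mul j _ ((contDiff_coord i).differentiable (by simp) x), pd_coord]

theorem divergence_omegaVac (Λ : ℝ) :
    divergence (omegaVac Λ) = fun _ => 3 * Real.sqrt (Λ / 3) := by
  funext x
  simp [divergence, dcomp_omegaVac]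

theorem isVacuumSolution_omegaVac {Λ : ℝ} (hΛ : 0 < Λ) :
    IsVacuumSolution Λ (omegaVac Λ) etaVac where
  smooth_omega := contDiff_id.const_smul (Real.sqrt (Λ / 3))
  smooth_eta := contDiff_const
  eta_pos _ := one_pos
  energy x := by
    have h := omegaVac_coeff_sq hΛ
    simp only [divergence_omegaVac, dcomp_omegaVac, etaVac, Fin.sum_univ_three]
    generalize Real.sqrt (Λ / 3) = l at h
    simp
    linear_combination -6 * h
  momentum x i := by
    have h : etaVac = fun _ => 1 := rfl
    simp [divergence_omegaVac, laplacianComp, dcomp_omegaVac, pd_const, h]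

theorem sphericallySymmetricAtInfinity_omegaVac (Λ : ℝ) :
    SphericallySymmetricAtInfinity (omegaVac Λ) etaVac := by
  refine ⟨1, one_pos, fun r => Real.sqrt (Λ / 3) * r, fun _ => 1, fun x hx => ⟨?_, rfl⟩⟩
  have hn : ‖x‖ ≠ 0 := by linarith
  rw [omegaVac, smul_smul, mul_assoc, mul_inv_cancel₀ hn, mul_one]

theorem arrowOfTime_omegaVac {Λ : ℝ} (hΛ : 0 < Λ) : ArrowOfTime (omegaVac Λ) etaVac := by
  intro x
  rw [divergence_omegaVac]
  have := Real.sqrt_pos.2 (show 0 < Λ / 3 by positivity)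
  rw [etaVac, div_one]
  positivity

end FFR

theorem mainTheorem2 (Λ : ℝ) (hΛ : 0 < Λ) :
    (FFR.IsVacuumSolution Λ (FFR.omegaVac Λ) FFR.etaVac ∧
      FFR.SphericallySymmetricAtInfinity (FFR.omegaVac Λ) FFR.etaVac ∧
      FFR.ArrowOfTime (FFR.omegaVac Λ) FFR.etaVac) ∧
    (∀ (ω : Slice → Slice) (η : Slice → ℝ),
      FFR.IsVacuumSolution Λ ω η → FFR.SphericallySymmetricAtInfinity ω η →
      FFR.ArrowOfTime ω η →
      FFR.SameUpToTimeRescaling ω η (FFR.omegaVac Λ) FFR.etaVac) ∧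
    (∀ (ω : Slice → Slice) (η : Slice → ℝ),
      FFR.IsVacuumSolution Λ ω η → FFR.SphericallySymmetricAtInfinity ω η →
      FFR.SameUpToTimeRescaling ω η (FFR.omegaVac Λ) FFR.etaVac ∨
        FFR.SameUpToTimeRescaling (-ω) η (FFR.omegaVac Λ) FFR.etaVac) :=
  ⟨⟨FFR.isVacuumSolution_omegaVac hΛ, FFR.sphericallySymmetricAtInfinity_omegaVac Λ,
    FFR.arrowOfTime_omegaVac hΛ⟩,
    fun _ _ hs hsym harrow => FFR.sameUpToTimeRescaling_of_arrowOfTime hΛ hs hsym harrow,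
    fun _ _ hs hsym => (FFR.arrowOfTime_or_neg hΛ hs).imp
      (FFR.sameUpToTimeRescaling_of_arrowOfTime hΛ hs hsym)
      (FFR.sameUpToTimeRescaling_of_arrowOfTime hΛ hs.neg hsym.neg)⟩
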